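/- There exist absolute constants $\tau_0\in(0,1)$, $C_1>0$ and $C'>0$ such that the following holds. Let $S,D\in\mathbb{R}^{m\times n}$ and $1\le r\le\min(m,n)-1$. Let $\sigma_1(\cdot)\ge\sigma_2(\cdot)\ge\dots$ denote singular values, $\|\cdot\|_F$ the Frobenius norm and $\|\cdot\|_2$ the spectral norm. Let $S=U\Sigma V^\top$ be a singular value decomposition, with the singular values in $\Sigma$ in decreasing order, let $U_r$ and $V_r$ consist of the first $r$ columns of $U$ and $V$, and put $$P_L=I-U_rU_r^\top,\qquad P_R=I-V_rV_r^\top,\qquad S_\perp=P_LSP_R,\qquad D_\perp=P_LDP_R.$$ Assume the spectral gap $\delta=\sigma_r(S)-\sigma_{r+1}(S)>0$. Let $\beta\in[0,1]$, $G=S+\beta D$ and $\tau=\beta\|D\|_2/\delta$, and assume $\tau\le\tau_0$. Then the tail energy $$E=\min_{\operatorname{rank}Q\le r}\|G-Q\|_F^2=\sum_{i>r}\sigma_i(G)^2$$ satisfies $$\bigl|E-\|S_\perp+\beta D_\perp\|_F^2\bigr|\le C_1\,\tau^2\bigl(\|S\|_F^2+\beta^2\|D\|_F^2\bigr).$$ Moreover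 $G\ne0$, and the tail ratio $\rho=\sqrt{E}/\|G\|_F$ and its fixed-subspace approximation $$\widetilde\rho=\frac{\|P_LGP_R\|_F}{\|G\|_F}=\frac{\|S_\perp+\beta D_\perp\|_F}{\|S+\beta D\|_F}$$ satisfy $|\rho-\widetilde\rho|\le C'\,\tau^2$. -/

import Mathlib

namespace FSFOA

/-- The Frobenius norm `‖A‖_F` of a real matrix. -/
noncomputable def frobNorm {m n : ℕ} (A : Matrix (Fin m) (Fin n) ℝ) : ℝ :=
  Matrix.frobeniusNormedAddCommGroup.toNorm.norm A

/-- The spectral norm `‖A‖₂` of a real matrix (operator norm for the Euclidean norms). -/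
noncomputable def specNorm {m n : ℕ} (A : Matrix (Fin m) (Fin n) ℝ) : ℝ :=
  Matrix.instL2OpNormedAddCommGroup.toNorm.norm A

/-- The singular values of a real matrix, in decreasing order, counted from `0`:
`sv A i` is the `(i + 1)`-st singular value `σ_{i+1}(A)`. -/
noncomputable def sv {m n : ℕ} (A : Matrix (Fin m) (Fin n) ℝ) (i : ℕ) : ℝ :=
  (Matrix.toEuclideanLin A).singularValues i

/-- The `m × n` diagonal matrix `Σ` of the singular values of `A`, in decreasing order. -/
noncomputable def svDiag {m n : ℕ} (A : Matrix (Fin m) (Fin n) ℝ) : Matrix (Fin m) (Fin n) ℝ :=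
  Matrix.of fun i j => if (i : ℕ) = (j : ℕ) then sv A i else 0

/-- `A = U Σ Vᵀ` is a (full) singular value decomposition: `U` and `V` are orthogonal and `Σ` is
the diagonal matrix of the singular values of `A` in decreasing order. -/
structure IsSVD {m n : ℕ} (A : Matrix (Fin m) (Fin n) ℝ)
    (U : Matrix (Fin m) (Fin m) ℝ) (V : Matrix (Fin n) (Fin n) ℝ) : Prop where
  left_orthogonal : U ∈ Matrix.orthogonalGroup (Fin m) ℝ
  right_orthogonal : V ∈ Matrix.orthogonalGroup (Fin n) ℝ
  decomposition : A = U * svDiag A * V.transpose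

/-- The matrix `U_r` formed by the first `r` columns of `U`. -/
def firstCols {k : ℕ} (U : Matrix (Fin k) (Fin k) ℝ) (r : ℕ) :
    Matrix (Fin k) {j : Fin k // (j : ℕ) < r} ℝ :=
  U.submatrix id Subtype.val

/-- The projection `I - U_r U_rᵀ` onto the orthogonal complement of the span of the first `r`
columns of `U` (for `U` orthogonal). -/
def complProj {k : ℕ} (U : Matrix (Fin k) (Fin k) ℝ) (r : ℕ) : Matrix (Fin k) (Fin k) ℝ :=
  1 - firstCols U r * (firstCols U r).transpose

/-- The tail energy `∑_{i > r} σ_i(A)²`. -/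
noncomputable def tailEnergy {m n : ℕ} (r : ℕ) (A : Matrix (Fin m) (Fin n) ℝ) : ℝ :=
  ∑ i ∈ Finset.Ico r (min m n), sv A i ^ 2

/-- The spectral gap `δ = σ_r(S) - σ_{r+1}(S)`, for `r ≥ 1`. -/
noncomputable def gap {m n : ℕ} (r : ℕ) (S : Matrix (Fin m) (Fin n) ℝ) : ℝ :=
  sv S (r - 1) - sv S r

/-- The relative perturbation `τ = β ‖D‖₂ / δ`. -/
noncomputable def relPert {m n : ℕ} (r : ℕ) (S D : Matrix (Fin m) (Fin n) ℝ) (β : ℝ) : ℝ :=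
  β * specNorm D / gap r S

/-- The true tail ratio `ρ = √(∑_{i > r} σ_i(A)²) / ‖A‖_F`. -/
noncomputable def tailRatio {m n : ℕ} (r : ℕ) (A : Matrix (Fin m) (Fin n) ℝ) : ℝ :=
  Real.sqrt (tailEnergy r A) / frobNorm A

end FSFOA

namespace FSFOA

open Matrix

/-! ### Frobenius and spectral norms, and their behaviour under products and orthogonal conjugation.
-/

section Norms

variable {l m n : ℕ}

/-! Let p, q be the tail projections of S and p', q' those of G. A matrix intertwines its own tail
projections, G q' = p' G, so √E is exactly ‖p' G‖_F, and the claim compares it with ‖p G q‖_F.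

Weyl's inequality keeps the cross gaps between S and G at least δ/2 when τ ≤ 1/2, so Wedin's theorem
(`wedin_sin_theta`), applied in both directions, bounds products such as p(1 - p') and (1 - q')q by
θ = 2τ. When either compression is expanded in terms of the other, every error term carries two such
small factors: the off-diagonal blocks of G for p, q are already O(θ), and the outer projections
contribute another θ. Thus |√E - ‖p G q‖_F| ≤ 5θ²‖G‖_F (`abs_frobNorm_compression_sub_le`,
`abs_sqrt_tailEnergy_sub_le`).

Estimating norms rather than squares matters: dividing by ‖G‖_F gives the ratio bound even when E is
tiny, and multiplying by the sum of the two norms gives the energy bound. The variational form of E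
is Eckart–Young (`isLeast_tailEnergy`), also a consequence of Weyl's inequality. -/

theorem frobNorm_sq (A : Matrix (Fin m) (Fin n) ℝ) :
    frobNorm A ^ 2 = ∑ i, ∑ j, A i j ^ 2 := by
  have h : frobNorm A = (∑ i, ∑ j, ‖A i j‖ ^ (2 : ℝ)) ^ (1 / 2 : ℝ) :=
    Matrix.frobenius_norm_def A
  rw [h, ← Real.sqrt_eq_rpow, Real.sq_sqrt (by positivity)]
  simp

theorem frobNorm_nonneg (A : Matrix (Fin m) (Fin n) ℝ) : 0 ≤ frobNorm A :=
  letI := Matrix.frobeniusNormedAddCommGroup (m := Fin m) (n := Fin n) (α := ℝ)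
  norm_nonneg A

theorem frobNorm_add_le (A B : Matrix (Fin m) (Fin n) ℝ) :
    frobNorm (A + B) ≤ frobNorm A + frobNorm B :=
  letI := Matrix.frobeniusNormedAddCommGroup (m := Fin m) (n := Fin n) (α := ℝ)
  norm_add_le A B

theorem frobNorm_smul (c : ℝ) (A : Matrix (Fin m) (Fin n) ℝ) :
    frobNorm (c • A) = |c| * frobNorm A :=
  letI := Matrix.frobeniusNormedAddCommGroup (m := Fin m) (n := Fin n) (α := ℝ)
  letI := Matrix.frobeniusNormedSpace (m := Fin m) (n := Fin n) (R := ℝ) (α := ℝ)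
  norm_smul c A

theorem frobNorm_transpose (A : Matrix (Fin m) (Fin n) ℝ) : frobNorm Aᵀ = frobNorm A :=
  Matrix.frobenius_norm_transpose A

theorem specNorm_nonneg (A : Matrix (Fin m) (Fin n) ℝ) : 0 ≤ specNorm A :=
  letI := Matrix.instL2OpNormedAddCommGroup (m := Fin m) (n := Fin n) (𝕜 := ℝ)
  norm_nonneg A

theorem specNorm_add_le (A B : Matrix (Fin m) (Fin n) ℝ) :
    specNorm (A + B) ≤ specNorm A + specNorm B :=
  letI := Matrix.instL2OpNormedAddCommGroup (m := Fin m) (n := Fin n) (𝕜 := ℝ)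
  norm_add_le A B

theorem specNorm_neg (A : Matrix (Fin m) (Fin n) ℝ) : specNorm (-A) = specNorm A :=
  letI := Matrix.instL2OpNormedAddCommGroup (m := Fin m) (n := Fin n) (𝕜 := ℝ)
  norm_neg A

theorem specNorm_smul (c : ℝ) (A : Matrix (Fin m) (Fin n) ℝ) :
    specNorm (c • A) = |c| * specNorm A :=
  letI := Matrix.instL2OpNormedAddCommGroup (m := Fin m) (n := Fin n) (𝕜 := ℝ)
  letI := Matrix.instL2OpNormedSpace (m := Fin m) (n := Fin n) (𝕜 := ℝ)
  norm_smul c A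

theorem specNorm_transpose (A : Matrix (Fin m) (Fin n) ℝ) : specNorm Aᵀ = specNorm A := by
  rw [← Matrix.conjTranspose_eq_transpose_of_trivial]
  exact Matrix.l2_opNorm_conjTranspose A

theorem specNorm_mul_le (A : Matrix (Fin l) (Fin m) ℝ) (B : Matrix (Fin m) (Fin n) ℝ) :
    specNorm (A * B) ≤ specNorm A * specNorm B :=
  Matrix.l2_opNorm_mul A B

theorem specNorm_transpose_mul_self (A : Matrix (Fin m) (Fin n) ℝ) :
    specNorm (Aᵀ * A) = specNorm A * specNorm A := by
  rw [← Matrix.conjTranspose_eq_transpose_of_trivial]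
  exact Matrix.l2_opNorm_conjTranspose_mul_self A

theorem norm_toEuclideanLin_le (A : Matrix (Fin m) (Fin n) ℝ) (x : EuclideanSpace ℝ (Fin n)) :
    ‖Matrix.toEuclideanLin A x‖ ≤ specNorm A * ‖x‖ :=
  Matrix.l2_opNorm_mulVec A x

theorem specNorm_diagonal_le {f : Fin n → ℝ} {c : ℝ} (hc : 0 ≤ c) (h : ∀ i, |f i| ≤ c) :
    specNorm (Matrix.diagonal f) ≤ c := by
  have : specNorm (Matrix.diagonal f) = ‖f‖ := Matrix.l2_opNorm_diagonal f
  rw [this]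
  exact (pi_norm_le_iff_of_nonneg hc).2 h

/-- The squared Frobenius norm is a sum over columns, and A acts on each column of B with operator
norm `specNorm A`. -/
theorem frobNorm_mul_le (A : Matrix (Fin l) (Fin m) ℝ) (B : Matrix (Fin m) (Fin n) ℝ) :
    frobNorm (A * B) ≤ specNorm A * frobNorm B := by
  refine le_of_sq_le_sq ?_ (mul_nonneg (specNorm_nonneg A) (frobNorm_nonneg B))
  rw [mul_pow, frobNorm_sq, frobNorm_sq, Finset.sum_comm, Finset.sum_comm (γ := Fin m),
    Finset.mul_sum]
  refine Finset.sum_le_sum fun j _ => ?_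
  have h := norm_toEuclideanLin_le A (WithLp.toLp 2 (fun i => B i j))
  have h2 := pow_le_pow_left₀ (norm_nonneg _) h 2
  rw [mul_pow, EuclideanSpace.norm_sq_eq, EuclideanSpace.norm_sq_eq] at h2
  simpa [Matrix.mul_apply, Matrix.mulVec, dotProduct] using h2

theorem frobNorm_mul_le' (A : Matrix (Fin l) (Fin m) ℝ) (B : Matrix (Fin m) (Fin n) ℝ) :
    frobNorm (A * B) ≤ frobNorm A * specNorm B := by
  rw [← frobNorm_transpose, Matrix.transpose_mul, mul_comm, ← specNorm_transpose B,
    ← frobNorm_transpose A]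
  exact frobNorm_mul_le _ _

theorem specNorm_orthogonal_le {U : Matrix (Fin n) (Fin n) ℝ}
    (hU : U ∈ Matrix.orthogonalGroup (Fin n) ℝ) : specNorm U ≤ 1 := by
  have h := specNorm_transpose_mul_self U
  have h1 : specNorm (1 : Matrix (Fin n) (Fin n) ℝ) ≤ 1 := by
    rw [← Matrix.diagonal_one]
    exact specNorm_diagonal_le zero_le_one (by simp)
  have h2 : Uᵀ * U = 1 := (Matrix.mem_orthogonalGroup_iff' _ _).1 hU
  rw [h2] at h
  nlinarith [specNorm_nonneg U]

theorem specNorm_conj_le {U : Matrix (Fin m) (Fin m) ℝ} {V : Matrix (Fin n) (Fin n) ℝ}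
    (hU : U ∈ Matrix.orthogonalGroup (Fin m) ℝ) (hV : V ∈ Matrix.orthogonalGroup (Fin n) ℝ)
    (A : Matrix (Fin m) (Fin n) ℝ) : specNorm (U * A * Vᵀ) ≤ specNorm A := by
  have h1 := specNorm_mul_le (U * A) Vᵀ
  have h2 := specNorm_mul_le U A
  rw [specNorm_transpose] at h1
  nlinarith [specNorm_orthogonal_le hU, specNorm_orthogonal_le hV, specNorm_nonneg A,
    specNorm_nonneg U, specNorm_nonneg V, specNorm_nonneg (U * A)]

theorem frobNorm_conj_le {U : Matrix (Fin m) (Fin m) ℝ} {V : Matrix (Fin n) (Fin n) ℝ}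
    (hU : U ∈ Matrix.orthogonalGroup (Fin m) ℝ) (hV : V ∈ Matrix.orthogonalGroup (Fin n) ℝ)
    (A : Matrix (Fin m) (Fin n) ℝ) : frobNorm (U * A * Vᵀ) ≤ frobNorm A := by
  have h1 := frobNorm_mul_le' (U * A) Vᵀ
  have h2 := frobNorm_mul_le U A
  rw [specNorm_transpose] at h1
  nlinarith [specNorm_orthogonal_le hU, specNorm_orthogonal_le hV, frobNorm_nonneg A,
    specNorm_nonneg U, specNorm_nonneg V, frobNorm_nonneg (U * A)]

theorem transpose_mem_orthogonalGroup {U : Matrix (Fin m) (Fin m) ℝ}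
    (hU : U ∈ Matrix.orthogonalGroup (Fin m) ℝ) : Uᵀ ∈ Matrix.orthogonalGroup (Fin m) ℝ := by
  rw [Matrix.mem_orthogonalGroup_iff]
  exact (Matrix.mem_orthogonalGroup_iff' _ _).1 hU

theorem frobNorm_conj {U : Matrix (Fin m) (Fin m) ℝ} {V : Matrix (Fin n) (Fin n) ℝ}
    (hU : U ∈ Matrix.orthogonalGroup (Fin m) ℝ) (hV : V ∈ Matrix.orthogonalGroup (Fin n) ℝ)
    (A : Matrix (Fin m) (Fin n) ℝ) : frobNorm (U * A * Vᵀ) = frobNorm A := by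
  refine (frobNorm_conj_le hU hV A).antisymm ?_
  have h := frobNorm_conj_le (transpose_mem_orthogonalGroup hU) (transpose_mem_orthogonalGroup hV)
    (U * A * Vᵀ)
  have e : Uᵀ * (U * A * Vᵀ) * Vᵀᵀ = A := by
    have hU' : Uᵀ * U = 1 := (Matrix.mem_orthogonalGroup_iff' _ _).1 hU
    have hV' : Vᵀ * V = 1 := (Matrix.mem_orthogonalGroup_iff' _ _).1 hV
    rw [Matrix.transpose_transpose, Matrix.mul_assoc U, ← Matrix.mul_assoc Uᵀ, hU', Matrix.one_mul,
      Matrix.mul_assoc, hV', Matrix.mul_one]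
  rwa [e] at h

end Norms

/-! ### Calculus of rectangular diagonal matrices. -/

section RectangularDiagonal

/-- The `m × n` matrix with diagonal entries `f 0, f 1, …` and zeros elsewhere. -/
def rectDiag (m n : ℕ) (f : ℕ → ℝ) : Matrix (Fin m) (Fin n) ℝ :=
  Matrix.of fun i j => if (i : ℕ) = (j : ℕ) then f i else 0

variable {m n : ℕ}

theorem rectDiag_one : rectDiag n n 1 = 1 := by
  ext i j
  simp [rectDiag, Matrix.one_apply, Fin.ext_iff]

theorem rectDiag_sub (f g : ℕ → ℝ) :
    rectDiag m n f - rectDiag m n g = rectDiag m n (f - g) := by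
  ext i j
  by_cases h : (i : ℕ) = j <;> simp [rectDiag, h]

theorem rectDiag_congr {f g : ℕ → ℝ} (h : ∀ i < min m n, f i = g i) :
    rectDiag m n f = rectDiag m n g := by
  ext i j
  by_cases hij : (i : ℕ) = j
  · simp only [rectDiag, Matrix.of_apply, hij, if_true]
    exact h _ (lt_min (hij ▸ i.2) j.2)
  · simp [rectDiag, hij]

/-- The inner dimension may be the smallest of the three and cut the product off at n; the
hypothesis says nothing is lost there. -/
theorem rectDiag_mul {k : ℕ} (f g : ℕ → ℝ)
    (h : ∀ i < min m k, n ≤ i → f i * g i = 0) :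
    rectDiag m n f * rectDiag n k g = rectDiag m k (f * g) := by
  ext i l
  simp only [rectDiag, Matrix.mul_apply, Matrix.of_apply, Pi.mul_apply]
  by_cases hi : (i : ℕ) < n
  · rw [Finset.sum_eq_single ⟨i, hi⟩]
    · by_cases hil : (i : ℕ) = l <;> simp [hil]
    · intro j _ hj
      rw [if_neg (fun e => hj (Fin.ext e.symm)), zero_mul]
    · simp
  · rw [Finset.sum_eq_zero]
    · split_ifs with hil
      · exact (h i (lt_min i.2 (hil ▸ l.2)) (not_lt.1 hi)).symm
      · rfl
    · intro j _
      rw [if_neg (fun e => hi (e.trans_lt j.2)), zero_mul]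

/-- By the C*-identity it suffices to bound the Gram matrix, which is square and diagonal. -/
theorem specNorm_rectDiag_le {f : ℕ → ℝ} {c : ℝ} (hc : 0 ≤ c) (h : ∀ i < min m n, |f i| ≤ c) :
    specNorm (rectDiag m n f) ≤ c := by
  have e : (rectDiag m n f)ᵀ * rectDiag m n f
      = Matrix.diagonal (fun j : Fin n => if (j : ℕ) < m then f j ^ 2 else 0) := by
    ext i l
    simp only [rectDiag, Matrix.mul_apply, Matrix.of_apply, Matrix.transpose_apply,
      Matrix.diagonal_apply]
    by_cases hi : (i : ℕ) < m
    · rw [Finset.sum_eq_single ⟨i, hi⟩]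
      · by_cases hil : i = l
        · simp [hil, sq, hil ▸ hi]
        · simp [hil, Fin.ext_iff.not.1 hil]
      · intro j _ hj
        rw [if_neg (fun e => hj (Fin.ext e)), zero_mul]
      · simp
    · rw [Finset.sum_eq_zero]
      · simp [hi]
      · intro j _
        rw [if_neg (fun e => hi (e.symm.trans_lt j.2)), zero_mul]
  have h1 := specNorm_transpose_mul_self (rectDiag m n f)
  have h2 : specNorm ((rectDiag m n f)ᵀ * rectDiag m n f) ≤ c ^ 2 := by
    rw [e]
    refine specNorm_diagonal_le (sq_nonneg c) fun i => ?_
    split_ifs with hi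
    · rw [abs_pow]
      exact pow_le_pow_left₀ (abs_nonneg _) (h i (lt_min hi i.2)) 2
    · simp [sq_nonneg c]
  rw [h1, ← sq] at h2
  exact le_of_sq_le_sq h2 hc

theorem frobNorm_rectDiag_sq (f : ℕ → ℝ) :
    frobNorm (rectDiag m n f) ^ 2 = ∑ i ∈ Finset.range (min m n), f i ^ 2 := by
  rw [frobNorm_sq]
  have h : ∀ i : Fin m, ∑ j : Fin n, rectDiag m n f i j ^ 2
      = if (i : ℕ) < n then f i ^ 2 else 0 := by
    intro i
    simp only [rectDiag, Matrix.of_apply]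
    split_ifs with hi
    · rw [Finset.sum_eq_single ⟨i, hi⟩]
      · simp
      · intro j _ hj
        rw [if_neg (fun e => hj (Fin.ext e.symm)), sq, zero_mul]
      · simp
    · refine Finset.sum_eq_zero fun j _ => ?_
      rw [if_neg (fun e => hi (e.trans_lt j.2)), sq, zero_mul]
  simp only [h]
  rw [Fin.sum_univ_eq_sum_range (fun i => if i < n then f i ^ 2 else 0) m, ← Finset.sum_filter]
  congr 1
  ext i
  simp

end RectangularDiagonal

/-! ### Singular vectors, Weyl's inequality, existence of the decomposition. -/

section SingularVectors

variable {m n : ℕ}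

theorem sv_nonneg (A : Matrix (Fin m) (Fin n) ℝ) (i : ℕ) : 0 ≤ sv A i :=
  LinearMap.singularValues_nonneg _ i

theorem sv_antitone (A : Matrix (Fin m) (Fin n) ℝ) : Antitone (sv A) :=
  LinearMap.singularValues_antitone _

theorem sv_eq_zero_of_rank_le {A : Matrix (Fin m) (Fin n) ℝ} {i : ℕ} (h : A.rank ≤ i) :
    sv A i = 0 := by
  refine (LinearMap.singularValues_eq_zero_iff_le_finrank_range _).2 ?_
  rw [Matrix.rank_eq_finrank_range_toLin A (EuclideanSpace.basisFun (Fin m) ℝ).toBasis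
    (EuclideanSpace.basisFun (Fin n) ℝ).toBasis] at h
  rwa [Matrix.toEuclideanLin, Matrix.toLpLin_eq_toLin]

/-- An orthonormal basis of right singular vectors. -/
theorem exists_right_singular_basis (A : Matrix (Fin m) (Fin n) ℝ) :
    ∃ b : OrthonormalBasis (Fin n) ℝ (EuclideanSpace ℝ (Fin n)), ∀ i j,
      inner ℝ (Matrix.toEuclideanLin A (b i)) (Matrix.toEuclideanLin A (b j))
        = if i = j then sv A i ^ 2 else 0 := by
  set T := Matrix.toEuclideanLin A
  have hn : Module.finrank ℝ (EuclideanSpace ℝ (Fin n)) = n := by simp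
  -- Right singular vectors are the eigenvectors of T*T, whose eigenvalues are the squared singular
  -- values.
  refine ⟨T.isSymmetric_adjoint_comp_self.eigenvectorBasis hn, fun i j => ?_⟩
  rw [← LinearMap.adjoint_inner_right, ← LinearMap.comp_apply,
    T.isSymmetric_adjoint_comp_self.apply_eigenvectorBasis hn j, inner_smul_right,
    OrthonormalBasis.inner_eq_ite]
  split_ifs with h
  · subst h
    simp only [sv]
    rw [LinearMap.sq_singularValues_fin _ hn]
    simp [T]
  · simp

theorem norm_sq_toEuclideanLin {A : Matrix (Fin m) (Fin n) ℝ}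
    {b : OrthonormalBasis (Fin n) ℝ (EuclideanSpace ℝ (Fin n))}
    (hb : ∀ i j, inner ℝ (Matrix.toEuclideanLin A (b i)) (Matrix.toEuclideanLin A (b j))
        = if i = j then sv A i ^ 2 else 0) (x : EuclideanSpace ℝ (Fin n)) :
    ‖Matrix.toEuclideanLin A x‖ ^ 2 = ∑ i : Fin n, sv A i ^ 2 * inner ℝ (b i) x ^ 2 := by
  conv_lhs => rw [← b.sum_repr' x]
  rw [map_sum, ← real_inner_self_eq_norm_sq, sum_inner]
  refine Finset.sum_congr rfl fun i _ => ?_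
  rw [inner_sum, Finset.sum_eq_single i]
  · rw [map_smul, inner_smul_left, inner_smul_right, hb, if_pos rfl]
    simp
    ring
  · intro j _ hj
    rw [map_smul, map_smul, inner_smul_left, inner_smul_right, hb, if_neg hj.symm]
    simp
  · simp

theorem norm_sq_eq_sum_inner (b : OrthonormalBasis (Fin n) ℝ (EuclideanSpace ℝ (Fin n)))
    (x : EuclideanSpace ℝ (Fin n)) : ‖x‖ ^ 2 = ∑ i, inner ℝ (b i) x ^ 2 := by
  rw [← b.sum_sq_norm_inner_right x]
  simp

/-- With `sv_mul_le_norm_toEuclideanLin`, the two halves of the min-max principle: only the singular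
values from index k on, respectively up to k, enter the expansion of the norm. -/
theorem norm_toEuclideanLin_le_sv {A : Matrix (Fin m) (Fin n) ℝ}
    {b : OrthonormalBasis (Fin n) ℝ (EuclideanSpace ℝ (Fin n))}
    (hb : ∀ i j, inner ℝ (Matrix.toEuclideanLin A (b i)) (Matrix.toEuclideanLin A (b j))
        = if i = j then sv A i ^ 2 else 0) {x : EuclideanSpace ℝ (Fin n)} {k : ℕ}
    (hx : ∀ i : Fin n, (i : ℕ) < k → inner ℝ (b i) x = 0) :
    ‖Matrix.toEuclideanLin A x‖ ≤ sv A k * ‖x‖ := by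
  refine le_of_sq_le_sq (a := (_ : ℝ)) ?_ (mul_nonneg (sv_nonneg A k) (norm_nonneg x))
  rw [mul_pow, norm_sq_toEuclideanLin hb, norm_sq_eq_sum_inner b, Finset.mul_sum]
  refine Finset.sum_le_sum fun i _ => ?_
  by_cases hi : (i : ℕ) < k
  · simp [hx i hi]
  · exact mul_le_mul_of_nonneg_right
      (pow_le_pow_left₀ (sv_nonneg A i) (sv_antitone A (not_lt.1 hi)) 2) (sq_nonneg _)

theorem sv_mul_le_norm_toEuclideanLin {A : Matrix (Fin m) (Fin n) ℝ}
    {b : OrthonormalBasis (Fin n) ℝ (EuclideanSpace ℝ (Fin n))}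
    (hb : ∀ i j, inner ℝ (Matrix.toEuclideanLin A (b i)) (Matrix.toEuclideanLin A (b j))
        = if i = j then sv A i ^ 2 else 0) {x : EuclideanSpace ℝ (Fin n)} {k : ℕ}
    (hx : ∀ i : Fin n, k < (i : ℕ) → inner ℝ (b i) x = 0) :
    sv A k * ‖x‖ ≤ ‖Matrix.toEuclideanLin A x‖ := by
  refine le_of_sq_le_sq ?_ (norm_nonneg _)
  rw [mul_pow, norm_sq_toEuclideanLin hb, norm_sq_eq_sum_inner b, Finset.mul_sum]
  refine Finset.sum_le_sum fun i _ => ?_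
  by_cases hi : k < (i : ℕ)
  · simp [hx i hi]
  · exact mul_le_mul_of_nonneg_right
      (pow_le_pow_left₀ (sv_nonneg A k) (sv_antitone A (not_lt.1 hi)) 2) (sq_nonneg _)

/-- Weyl's inequality for singular values. -/
theorem sv_add_le (A B : Matrix (Fin m) (Fin n) ℝ) (i j : ℕ) :
    sv (A + B) (i + j) ≤ sv A i + sv B j := by
  by_cases hij : n ≤ i + j
  · rw [sv_eq_zero_of_rank_le ((Matrix.rank_le_width _).trans hij)]
    exact add_nonneg (sv_nonneg _ _) (sv_nonneg _ _)
  push Not at hij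
  obtain ⟨a, ha⟩ := exists_right_singular_basis A
  obtain ⟨b, hb⟩ := exists_right_singular_basis B
  obtain ⟨c, hc⟩ := exists_right_singular_basis (A + B)
  -- The map imposes i + j + (n - (i + j + 1)) = n - 1 linear conditions on n unknowns, so some
  -- nonzero x is orthogonal to the leading vectors of A and B and to the trailing ones of A + B.
  let L : EuclideanSpace ℝ (Fin n) →ₗ[ℝ]
      ((Fin i → ℝ) × (Fin j → ℝ) × (Fin (n - (i + j + 1)) → ℝ)) :=
    (LinearMap.pi fun k : Fin (i) => (innerSL ℝ (a ⟨k, by omega⟩)).toLinearMap).prod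
      ((LinearMap.pi fun k : Fin (j) => (innerSL ℝ (b ⟨k, by omega⟩)).toLinearMap).prod
        (LinearMap.pi fun k : Fin (n - (i + j + 1)) =>
          (innerSL ℝ (c ⟨i + j + 1 + k, by omega⟩)).toLinearMap))
  have hL : LinearMap.ker L ≠ ⊥ := by
    apply LinearMap.ker_ne_bot_of_finrank_lt
    simp
    omega
  obtain ⟨x, hxL, hx0⟩ := (Submodule.ne_bot_iff _).1 hL
  rw [LinearMap.mem_ker] at hxL
  have h1 := congrArg Prod.fst hxL
  have h2 := congrArg (fun y => y.2.1) hxL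
  have h3 := congrArg (fun y => y.2.2) hxL
  have e1 : ∀ k : Fin n, (k : ℕ) < i → inner ℝ (a k) x = 0 := fun k hk => by
    simpa [L] using congrFun h1 ⟨k, hk⟩
  have e2 : ∀ k : Fin n, (k : ℕ) < j → inner ℝ (b k) x = 0 := fun k hk => by
    simpa [L] using congrFun h2 ⟨k, hk⟩
  have e3 : ∀ k : Fin n, i + j < (k : ℕ) → inner ℝ (c k) x = 0 := fun k hk => by
    have hk' : i + j + 1 + ((k : ℕ) - (i + j + 1)) = k := by omega
    have := congrFun h3 ⟨k - (i + j + 1), by omega⟩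
    simpa [L, hk'] using this
  have f1 := norm_toEuclideanLin_le_sv ha e1
  have f2 := norm_toEuclideanLin_le_sv hb e2
  have f3 := sv_mul_le_norm_toEuclideanLin hc e3
  rw [map_add, LinearMap.add_apply] at f3
  have f4 := norm_add_le (Matrix.toEuclideanLin A x) (Matrix.toEuclideanLin B x)
  have hx : 0 < ‖x‖ := norm_pos_iff.2 hx0
  refine le_of_mul_le_mul_right ?_ hx
  linarith

theorem sv_zero_le_specNorm (A : Matrix (Fin m) (Fin n) ℝ) : sv A 0 ≤ specNorm A := by
  obtain ⟨b, hb⟩ := exists_right_singular_basis A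
  rcases Nat.eq_zero_or_pos n with hn | hn
  · rw [sv_eq_zero_of_rank_le ((Matrix.rank_le_width A).trans hn.le)]
    exact specNorm_nonneg A
  · have h := (sv_mul_le_norm_toEuclideanLin hb (x := b ⟨0, hn⟩) (k := 0) fun i hi => by
      rw [b.inner_eq_ite, if_neg]
      rintro rfl
      exact lt_irrefl _ hi).trans (norm_toEuclideanLin_le A _)
    simpa using h

theorem sv_le_add_specNorm (A B : Matrix (Fin m) (Fin n) ℝ) (i : ℕ) :
    sv A i ≤ sv B i + specNorm (A - B) := by
  have h := sv_add_le B (A - B) i 0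
  rw [add_sub_cancel, add_zero] at h
  exact h.trans (by gcongr; exact sv_zero_le_specNorm _)

/-- The matrix whose columns are the vectors of an orthonormal basis is orthogonal. -/
theorem of_orthonormalBasis_mem_orthogonalGroup
    (b : OrthonormalBasis (Fin n) ℝ (EuclideanSpace ℝ (Fin n))) :
    (Matrix.of fun i j => b j i) ∈ Matrix.orthogonalGroup (Fin n) ℝ := by
  rw [Matrix.mem_orthogonalGroup_iff']
  ext i j
  have h := b.inner_eq_ite i j
  rw [PiLp.inner_apply] at h
  simpa [Matrix.mul_apply, Matrix.one_apply, mul_comm] using h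

/-- Every real matrix has a singular value decomposition. -/
theorem exists_isSVD (A : Matrix (Fin m) (Fin n) ℝ) : ∃ U V, IsSVD A U V := by
  obtain ⟨b, hb⟩ := exists_right_singular_basis A
  set T := Matrix.toEuclideanLin A with hT
  -- Left singular vectors are normalized images of right ones. Only indices in `s`, where the
  -- singular value is nonzero, matter; the others are filled in by extending to an orthonormal
  -- basis.
  let w : Fin m → EuclideanSpace ℝ (Fin m) := fun i =>
    if h : (i : ℕ) < n then (sv A i)⁻¹ • T (b ⟨i, h⟩) else 0
  let s : Set (Fin m) := {i | sv A i ≠ 0}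
  have hlt : ∀ i : Fin m, i ∈ s → (i : ℕ) < n := fun i hi => by
    by_contra hn
    exact hi (sv_eq_zero_of_rank_le ((Matrix.rank_le_width A).trans (not_lt.1 hn)))
  have hw : Orthonormal ℝ (s.domRestrict w) := by
    rw [orthonormal_iff_ite]
    rintro ⟨i, hi⟩ ⟨j, hj⟩
    have hi' : sv A i ≠ 0 := hi
    have ei : w i = (sv A i)⁻¹ • T (b ⟨i, hlt i hi⟩) := dif_pos _
    have ej : w j = (sv A j)⁻¹ • T (b ⟨j, hlt j hj⟩) := dif_pos _
    simp only [Set.domRestrict_apply, ei, ej, inner_smul_left,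
      inner_smul_right, hb, Fin.mk.injEq, Subtype.mk.injEq, Fin.val_inj]
    split_ifs with h
    · subst h
      simp only [conj_trivial]
      field_simp
    · simp
  obtain ⟨u, hu⟩ := hw.exists_orthonormalBasis_extension_of_card_eq (by simp)
  refine ⟨Matrix.of fun i j => u j i, Matrix.of fun i j => b j i,
    of_orthonormalBasis_mem_orthogonalGroup u, of_orthonormalBasis_mem_orthogonalGroup b, ?_⟩
  have hV := of_orthonormalBasis_mem_orthogonalGroup b
  set V : Matrix (Fin n) (Fin n) ℝ := Matrix.of fun i j => b j i
  have key : A * V = (Matrix.of fun i j => u j i) * svDiag A := by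
    ext i j
    have hl : (A * V) i j = T (b j) i := by
      simp [hT, Matrix.mul_apply, V, Matrix.mulVec, dotProduct]
    rw [hl]
    by_cases h0 : sv A j = 0
    · have hz : T (b j) = 0 := by
        have h := hb j j
        rw [if_pos rfl, h0] at h
        simpa using h
      rw [hz, Matrix.mul_apply, Finset.sum_eq_zero]
      · rfl
      · intro k _
        simp only [svDiag, Matrix.of_apply]
        split_ifs with hk
        · rw [hk, h0, mul_zero]
        · rw [mul_zero]
    · have hjm : (j : ℕ) < m := by
        by_contra hn
        exact h0 (sv_eq_zero_of_rank_le ((Matrix.rank_le_height A).trans (not_lt.1 hn)))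
      have huj := hu ⟨j, hjm⟩ h0
      rw [Matrix.mul_apply, Finset.sum_eq_single ⟨j, hjm⟩]
      · simp only [Matrix.of_apply, huj, svDiag, w, dif_pos j.2, if_true, PiLp.smul_apply,
          smul_eq_mul]
        field_simp
      · intro k _ hk
        simp only [svDiag, Matrix.of_apply]
        rw [if_neg (fun e => hk (Fin.ext e)), mul_zero]
      · simp
  have hV' : V * Vᵀ = 1 := (Matrix.mem_orthogonalGroup_iff _ _).1 hV
  rw [← key, Matrix.mul_assoc, hV', Matrix.mul_one]

end SingularVectors

/-! ### Tail projections, pseudo-inverse and the Eckart–Young theorem. -/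

section Projections

variable {k l m n : ℕ}

theorem conj_mul_conj {W : Matrix (Fin l) (Fin l) ℝ} (hW : W ∈ Matrix.orthogonalGroup (Fin l) ℝ)
    (U : Matrix (Fin k) (Fin k) ℝ) (Z : Matrix (Fin m) (Fin m) ℝ)
    (X : Matrix (Fin k) (Fin l) ℝ) (Y : Matrix (Fin l) (Fin m) ℝ) :
    U * X * Wᵀ * (W * Y * Zᵀ) = U * (X * Y) * Zᵀ := by
  have h : Wᵀ * W = 1 := (Matrix.mem_orthogonalGroup_iff' _ _).1 hW
  calc U * X * Wᵀ * (W * Y * Zᵀ) = U * X * (Wᵀ * W) * Y * Zᵀ := by simp only [Matrix.mul_assoc]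
    _ = U * (X * Y) * Zᵀ := by rw [h, Matrix.mul_one]; simp only [Matrix.mul_assoc]

/-- The indicator of the indices below `r`. -/
def headInd (r i : ℕ) : ℝ := if i < r then 1 else 0

theorem firstCols_mul_transpose (U : Matrix (Fin k) (Fin k) ℝ) (r : ℕ) :
    firstCols U r * (firstCols U r)ᵀ = U * rectDiag k k (headInd r) * Uᵀ := by
  ext i l
  have h : ∀ j, (U * rectDiag k k (headInd r)) i j = if (j : ℕ) < r then U i j else 0 := by
    intro j
    rw [Matrix.mul_apply, Finset.sum_eq_single j]
    · simp [rectDiag, headInd]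
    · intro a _ ha
      simp [rectDiag, Fin.val_inj, ha]
    · simp
  rw [Matrix.mul_apply, Matrix.mul_apply]
  simp only [h, ite_mul, zero_mul, Matrix.transpose_apply, firstCols, Matrix.submatrix_apply, id]
  rw [← Finset.sum_filter, ← Finset.sum_subtype_eq_sum_filter]
  simp [Finset.subtype_univ]

theorem one_sub_complProj (U : Matrix (Fin k) (Fin k) ℝ) (r : ℕ) :
    1 - complProj U r = U * rectDiag k k (headInd r) * Uᵀ := by
  rw [complProj, sub_sub_cancel, firstCols_mul_transpose]

theorem complProj_eq {U : Matrix (Fin k) (Fin k) ℝ} (hU : U ∈ Matrix.orthogonalGroup (Fin k) ℝ)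
    (r : ℕ) : complProj U r = U * rectDiag k k (1 - headInd r) * Uᵀ := by
  have h : U * Uᵀ = 1 := (Matrix.mem_orthogonalGroup_iff _ _).1 hU
  rw [complProj, firstCols_mul_transpose, ← rectDiag_sub, Matrix.mul_sub, Matrix.sub_mul,
    rectDiag_one, Matrix.mul_one, h]

theorem complProj_transpose (U : Matrix (Fin k) (Fin k) ℝ) (r : ℕ) :
    (complProj U r)ᵀ = complProj U r := by
  simp [complProj]

theorem complProj_mul_self {U : Matrix (Fin k) (Fin k) ℝ}
    (hU : U ∈ Matrix.orthogonalGroup (Fin k) ℝ) (r : ℕ) :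
    complProj U r * complProj U r = complProj U r := by
  rw [complProj_eq hU, conj_mul_conj hU, rectDiag_mul]
  · congr 3
    ext i
    by_cases h : i < r <;> simp [headInd, h]
  · intro i hi hk
    exact absurd (hi.trans_le (min_le_left _ _)) (not_lt.2 hk)

theorem specNorm_complProj_le {U : Matrix (Fin k) (Fin k) ℝ}
    (hU : U ∈ Matrix.orthogonalGroup (Fin k) ℝ) (r : ℕ) : specNorm (complProj U r) ≤ 1 := by
  rw [complProj_eq hU]
  refine (specNorm_conj_le hU hU _).trans (specNorm_rectDiag_le zero_le_one fun i _ => ?_)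
  by_cases h : i < r <;> simp [headInd, h]

theorem specNorm_one_sub_complProj_le {U : Matrix (Fin k) (Fin k) ℝ}
    (hU : U ∈ Matrix.orthogonalGroup (Fin k) ℝ) (r : ℕ) : specNorm (1 - complProj U r) ≤ 1 := by
  rw [one_sub_complProj]
  refine (specNorm_conj_le hU hU _).trans (specNorm_rectDiag_le zero_le_one fun i _ => ?_)
  by_cases h : i < r <;> simp [headInd, h]

theorem rank_one_sub_complProj_mul_le (U : Matrix (Fin m) (Fin m) ℝ) (r : ℕ)
    (A : Matrix (Fin m) (Fin n) ℝ) : ((1 - complProj U r) * A).rank ≤ r := by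
  rw [complProj, sub_sub_cancel]
  refine (Matrix.rank_mul_le_left _ _).trans ((Matrix.rank_mul_le_left _ _).trans
    ((Matrix.rank_le_card_width _).trans ?_))
  have h := Fintype.card_le_of_injective
    (fun j : {j : Fin m // (j : ℕ) < r} => (⟨j.1, j.2⟩ : Fin r))
    (fun a b hab => Subtype.ext (Fin.ext (by simpa using hab)))
  rwa [Fintype.card_fin] at h

variable {A : Matrix (Fin m) (Fin n) ℝ} {U : Matrix (Fin m) (Fin m) ℝ}
  {V : Matrix (Fin n) (Fin n) ℝ}

theorem IsSVD.eq_rectDiag (h : IsSVD A U V) : A = U * rectDiag m n (sv A) * Vᵀ :=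
  h.decomposition

theorem IsSVD.complProj_mul (h : IsSVD A U V) (r : ℕ) :
    complProj U r * A = U * rectDiag m n ((1 - headInd r) * sv A) * Vᵀ := by
  conv_lhs => rw [h.eq_rectDiag]
  rw [complProj_eq h.left_orthogonal, conj_mul_conj h.left_orthogonal, rectDiag_mul]
  intro i hi hk
  exact absurd (hi.trans_le (min_le_left _ _)) (not_lt.2 hk)

/-- In the singular bases both sides multiply the diagonal by the same tail indicator. This
intertwining lets one projection be traded for the other throughout the perturbation argument. -/
theorem IsSVD.mul_complProj (h : IsSVD A U V) (r : ℕ) :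
    A * complProj V r = complProj U r * A := by
  rw [h.complProj_mul, mul_comm (1 - headInd r)]
  conv_lhs => rw [h.eq_rectDiag]
  rw [complProj_eq h.right_orthogonal, conj_mul_conj h.right_orthogonal, rectDiag_mul]
  intro i hi hk
  exact absurd (hi.trans_le (min_le_right _ _)) (not_lt.2 hk)

theorem IsSVD.complProj_mul_mul_complProj (h : IsSVD A U V) (r : ℕ) :
    complProj U r * A * complProj V r = complProj U r * A := by
  rw [Matrix.mul_assoc, h.mul_complProj, ← Matrix.mul_assoc,
    complProj_mul_self h.left_orthogonal]

theorem IsSVD.specNorm_complProj_mul_le (h : IsSVD A U V) (r : ℕ) :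
    specNorm (complProj U r * A) ≤ sv A r := by
  rw [h.complProj_mul]
  refine (specNorm_conj_le h.left_orthogonal h.right_orthogonal _).trans
    (specNorm_rectDiag_le (sv_nonneg A r) fun i _ => ?_)
  by_cases hi : i < r
  · simpa [headInd, hi] using sv_nonneg A r
  · simpa [headInd, hi, abs_of_nonneg (sv_nonneg A i)] using sv_antitone A (not_lt.1 hi)

theorem IsSVD.frobNorm_complProj_mul_sq (h : IsSVD A U V) (r : ℕ) :
    frobNorm (complProj U r * A) ^ 2 = tailEnergy r A := by
  rw [h.complProj_mul, frobNorm_conj h.left_orthogonal h.right_orthogonal, frobNorm_rectDiag_sq,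
    tailEnergy]
  symm
  refine Finset.sum_subset_zero_on_sdiff ?_ ?_ ?_
  · intro i hi
    exact Finset.mem_range.2 (Finset.mem_Ico.1 hi).2
  · intro i hi
    have : i < r := by
      simp only [Finset.mem_sdiff, Finset.mem_range, Finset.mem_Ico] at hi
      omega
    simp [headInd, this]
  · intro i hi
    simp [headInd, not_lt.2 (Finset.mem_Ico.1 hi).1]

theorem frobNorm_sq_eq_sum_sv (A : Matrix (Fin m) (Fin n) ℝ) :
    frobNorm A ^ 2 = ∑ i ∈ Finset.range (min m n), sv A i ^ 2 := by
  obtain ⟨U, V, h⟩ := exists_isSVD A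
  conv_lhs => rw [h.eq_rectDiag]
  rw [frobNorm_conj h.left_orthogonal h.right_orthogonal, frobNorm_rectDiag_sq]

/-- The leading part of a matrix of rank at least `r` has a pseudo-inverse of norm `1 / σ_r`. -/
theorem IsSVD.exists_pseudoInverse (h : IsSVD A U V) {r : ℕ} (hr : r ≤ min m n)
    (hpos : 0 < sv A (r - 1)) :
    ∃ J : Matrix (Fin n) (Fin m) ℝ, specNorm J ≤ (sv A (r - 1))⁻¹ ∧
      (1 - complProj U r) * A * J = 1 - complProj U r ∧
      J * (A * (1 - complProj V r)) = 1 - complProj V r := by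
  have hi : ∀ i, i < r → sv A (r - 1) ≤ sv A i := fun i hi => sv_antitone A (by omega)
  have hm := hr.trans (min_le_left _ _)
  have hn := hr.trans (min_le_right _ _)
  -- Invert the first r singular values and discard the rest; r ≤ min m n ensures that no inverted
  -- entry is truncated.
  refine ⟨V * rectDiag n m (headInd r * (sv A)⁻¹) * Uᵀ, ?_, ?_, ?_⟩
  · refine (specNorm_conj_le h.right_orthogonal h.left_orthogonal _).trans
      (specNorm_rectDiag_le (inv_nonneg.2 hpos.le) fun i _ => ?_)
    by_cases hir : i < r
    · simpa [headInd, hir, abs_of_nonneg (sv_nonneg A i)] using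
        (inv_anti₀ hpos (hi i hir))
    · simpa [headInd, hir] using sv_nonneg A (r - 1)
  · rw [one_sub_complProj]
    conv_lhs => enter [1, 2]; rw [h.eq_rectDiag]
    rw [conj_mul_conj h.left_orthogonal, conj_mul_conj h.right_orthogonal, rectDiag_mul,
      rectDiag_mul]
    · congr 2
      refine rectDiag_congr fun i _ => ?_
      by_cases hir : i < r
      · simp [headInd, hir, (hpos.trans_le (hi i hir)).ne']
      · simp [headInd, hir]
    · intro i _ hk
      simp [headInd, not_lt.2 (hn.trans hk)]
    · intro i _ hk
      simp [headInd, not_lt.2 (hm.trans hk)]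
  · rw [one_sub_complProj]
    conv_lhs => enter [2, 1]; rw [h.eq_rectDiag]
    rw [conj_mul_conj h.right_orthogonal, conj_mul_conj h.left_orthogonal, rectDiag_mul,
      rectDiag_mul]
    · congr 2
      refine rectDiag_congr fun i _ => ?_
      by_cases hir : i < r
      · simp [headInd, hir, (hpos.trans_le (hi i hir)).ne']
      · simp [headInd, hir]
    · intro i _ hk
      simp [headInd, not_lt.2 (hm.trans hk)]
    · intro i _ hk
      simp [headInd, not_lt.2 (hn.trans hk)]

/-- The Eckart–Young theorem for the Frobenius norm. -/
theorem isLeast_tailEnergy (r : ℕ) (A : Matrix (Fin m) (Fin n) ℝ) :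
    IsLeast {e : ℝ | ∃ Q : Matrix (Fin m) (Fin n) ℝ, Q.rank ≤ r ∧ e = frobNorm (A - Q) ^ 2}
      (tailEnergy r A) := by
  constructor
  · obtain ⟨U, V, h⟩ := exists_isSVD A
    refine ⟨(1 - complProj U r) * A, rank_one_sub_complProj_mul_le U r A, ?_⟩
    rw [← h.frobNorm_complProj_mul_sq, Matrix.sub_mul, Matrix.one_mul, sub_sub_cancel]
  · rintro e ⟨Q, hQ, rfl⟩
    rw [frobNorm_sq_eq_sum_sv, tailEnergy, Finset.sum_Ico_eq_sum_range]
    calc ∑ i ∈ Finset.range (min m n - r), sv A (r + i) ^ 2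
        ≤ ∑ i ∈ Finset.range (min m n - r), sv (A - Q) i ^ 2 := by
          refine Finset.sum_le_sum fun i _ => pow_le_pow_left₀ (sv_nonneg _ _) ?_ 2
          -- Since Q has rank at most r, `sv Q r` vanishes, and Weyl's inequality bounds each tail
          -- singular value of A by one of A - Q.
          have h := sv_add_le Q (A - Q) r i
          rwa [add_sub_cancel, sv_eq_zero_of_rank_le hQ, zero_add] at h
      _ ≤ ∑ i ∈ Finset.range (min m n), sv (A - Q) i ^ 2 :=
          Finset.sum_le_sum_of_subset_of_nonneg (Finset.range_mono (Nat.sub_le _ _))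
            fun i _ _ => sq_nonneg _

end Projections

/-! ### Perturbation of the tail subspaces and of the tail norm. -/

section Perturbation

variable {m n : ℕ}

/-- Wedin's `sin Θ` theorem in the spectral norm. -/
theorem wedin_sin_theta {S G : Matrix (Fin m) (Fin n) ℝ} {U U' : Matrix (Fin m) (Fin m) ℝ}
    {V V' : Matrix (Fin n) (Fin n) ℝ} (hS : IsSVD S U V) (hG : IsSVD G U' V') {r : ℕ}
    (hr : r ≤ min m n) {g : ℝ} (hg : 0 < g) (hgap : g ≤ sv G (r - 1) - sv S r) :
    g * specNorm (complProj U r * (1 - complProj U' r)) ≤ specNorm (G - S) ∧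
      g * specNorm ((1 - complProj V' r) * complProj V r) ≤ specNorm (G - S) := by
  have hs : 0 < sv G (r - 1) := by linarith [sv_nonneg S r]
  obtain ⟨J, hJ, hJ1, hJ2⟩ := hG.exists_pseudoInverse hr hs
  have hGc := hG.mul_complProj r
  have hSc := hS.mul_complProj r
  have hSp := hS.complProj_mul_mul_complProj r
  have hSn := hS.specNorm_complProj_mul_le r
  have np := specNorm_complProj_le hS.left_orthogonal r
  have nq := specNorm_complProj_le hS.right_orthogonal r
  have nh := specNorm_one_sub_complProj_le hG.left_orthogonal r
  have nk := specNorm_one_sub_complProj_le hG.right_orthogonal r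
  have pp := complProj_mul_self hS.left_orthogonal r
  have pt := complProj_transpose U r
  have qt := complProj_transpose V r
  have ht : (1 - complProj U' r)ᵀ = 1 - complProj U' r := by
    rw [Matrix.transpose_sub, complProj_transpose, Matrix.transpose_one]
  have kt : (1 - complProj V' r)ᵀ = 1 - complProj V' r := by
    rw [Matrix.transpose_sub, complProj_transpose, Matrix.transpose_one]
  have hGk : G * (1 - complProj V' r) = (1 - complProj U' r) * G := by
    rw [Matrix.mul_sub, Matrix.sub_mul, hGc, Matrix.mul_one, Matrix.one_mul]
  set p := complProj U r
  set q := complProj V r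
  set h := 1 - complProj U' r
  set k := 1 - complProj V' r
  set a := specNorm (p * h) with ha
  set b := specNorm (k * q) with hb
  have ha' : specNorm (h * p) = a := by
    rw [ha, ← specNorm_transpose, Matrix.transpose_mul, pt, ht]
  have hb' : specNorm (q * k) = b := by
    rw [hb, ← specNorm_transpose, Matrix.transpose_mul, qt, kt]
  have a0 : 0 ≤ a := specNorm_nonneg _
  have b0 : 0 ≤ b := specNorm_nonneg _
  have e0 : 0 ≤ specNorm (G - S) := specNorm_nonneg _
  have triple : ∀ {i j : ℕ} (X : Matrix (Fin i) (Fin m) ℝ) (Y : Matrix (Fin n) (Fin j) ℝ),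
      specNorm X ≤ 1 → specNorm Y ≤ 1 → specNorm (X * (G - S) * Y) ≤ specNorm (G - S) := by
    intro i j X Y hX hY
    have h1 := specNorm_mul_le (X * (G - S)) Y
    have h2 := specNorm_mul_le X (G - S)
    nlinarith [specNorm_nonneg X, specNorm_nonneg Y, specNorm_nonneg (X * (G - S))]
  -- Since h G = G k, one has p h G = p S q k + p (G - S) k; applying `J` on the right recovers p h.
  -- The mirror identity `i2` uses `J` on the left.
  have i1 : sv G (r - 1) * a ≤ sv S r * b + specNorm (G - S) := by
    have e1 : p * h = (p * S * (q * k) + p * (G - S) * k) * J := by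
      have : p * S * (q * k) + p * (G - S) * k = p * (h * G) := by
        rw [← Matrix.mul_assoc, hSp, ← hGk, Matrix.mul_sub p G S, Matrix.sub_mul,
          ← Matrix.mul_assoc]
        abel
      rw [this, Matrix.mul_assoc, hJ1]
    have e2 : a ≤ (sv S r * b + specNorm (G - S)) * (sv G (r - 1))⁻¹ := by
      rw [ha, e1]
      refine (specNorm_mul_le _ _).trans (mul_le_mul ?_ hJ (specNorm_nonneg _)
        (add_nonneg (mul_nonneg (sv_nonneg _ _) b0) e0))
      refine (specNorm_add_le _ _).trans (add_le_add ?_ (triple p k np nk))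
      refine (specNorm_mul_le _ _).trans ?_
      rw [hb']
      exact mul_le_mul_of_nonneg_right hSn b0
    rw [mul_comm]
    exact (le_mul_inv_iff₀ hs).1 e2
  have i2 : sv G (r - 1) * b ≤ sv S r * a + specNorm (G - S) := by
    have e1 : k * q = J * (h * p * (p * S) + h * (G - S) * q) := by
      have : h * p * (p * S) + h * (G - S) * q = (G * k) * q := by
        rw [Matrix.mul_assoc h p, ← Matrix.mul_assoc p p, pp, ← hSc, hGk, Matrix.mul_sub h G S,
          Matrix.sub_mul (h * G), ← Matrix.mul_assoc h S]
        abel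
      rw [this, ← Matrix.mul_assoc, hJ2]
    have e2 : b ≤ (sv G (r - 1))⁻¹ * (sv S r * a + specNorm (G - S)) := by
      rw [hb, e1]
      refine (specNorm_mul_le _ _).trans (mul_le_mul hJ ?_ (specNorm_nonneg _)
        (inv_nonneg.2 hs.le))
      refine (specNorm_add_le _ _).trans (add_le_add ?_ (triple h q nh nq))
      refine (specNorm_mul_le _ _).trans ?_
      rw [ha', mul_comm]
      exact mul_le_mul_of_nonneg_right hSn a0
    exact (le_inv_mul_iff₀ hs).1 e2
  have s0 := sv_nonneg S r
  -- In the inequality for the larger of a and b, the smaller one may be replaced by it; the gap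
  -- then bounds it, hence both.
  rcases le_total a b with hab | hab
  · have : g * b ≤ specNorm (G - S) := by nlinarith
    exact ⟨(mul_le_mul_of_nonneg_left hab hg.le).trans this, this⟩
  · have : g * a ≤ specNorm (G - S) := by nlinarith
    exact ⟨this, (mul_le_mul_of_nonneg_left hab hg.le).trans this⟩

theorem frobNorm_mul_mul_le (X : Matrix (Fin m) (Fin m) ℝ) (A : Matrix (Fin m) (Fin n) ℝ)
    (Y : Matrix (Fin n) (Fin n) ℝ) {a b c : ℝ} (hX : specNorm X ≤ a) (hA : frobNorm A ≤ c)
    (hY : specNorm Y ≤ b) : frobNorm (X * A * Y) ≤ a * c * b := by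
  have a0 : 0 ≤ a := (specNorm_nonneg _).trans hX
  have c0 : 0 ≤ c := (frobNorm_nonneg _).trans hA
  refine (frobNorm_mul_le' _ _).trans (mul_le_mul ?_ hY (specNorm_nonneg _) (mul_nonneg a0 c0))
  exact (frobNorm_mul_le _ _).trans (mul_le_mul hX hA (frobNorm_nonneg _) a0)

/-- If a matrix `G` commutes with the projections `p'`, `q'`, and `p`, `q` are `θ`-close to them,
the compressions of `G` by the two pairs agree to second order in `θ`. -/
theorem abs_frobNorm_compression_sub_le {G : Matrix (Fin m) (Fin n) ℝ}
    {p p' : Matrix (Fin m) (Fin m) ℝ} {q q' : Matrix (Fin n) (Fin n) ℝ} {θ : ℝ}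
    (hpp : p * p = p) (hqq : q * q = q) (hp : p' * p' = p')
    (hG : G * q' = p' * G)
    (np : specNorm p ≤ 1) (nq : specNorm q ≤ 1) (np' : specNorm p' ≤ 1) (nq' : specNorm q' ≤ 1)
    (nh : specNorm (1 - p) ≤ 1) (nk : specNorm (1 - q) ≤ 1)
    (ph : specNorm (p * (1 - p')) ≤ θ) (hp' : specNorm ((1 - p) * p') ≤ θ)
    (p'h : specNorm (p' * (1 - p)) ≤ θ)
    (kq : specNorm ((1 - q') * q) ≤ θ) (q'k : specNorm (q' * (1 - q)) ≤ θ)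
    (kq' : specNorm ((1 - q) * q') ≤ θ) :
    |frobNorm (p' * G) - frobNorm (p * G * q)| ≤ 5 * θ ^ 2 * frobNorm G := by
  have hpGq : p' * G = p' * G * q' := by
    rw [Matrix.mul_assoc, hG, ← Matrix.mul_assoc, hp]
  set N := frobNorm G
  have N0 : 0 ≤ N := frobNorm_nonneg G
  have upper : frobNorm (p * G * q) ≤ frobNorm (p' * G) + θ ^ 2 * N := by
    -- Splitting G by p' leaves (1 - p')G, which equals (1 - p')G(1 - q') by intertwining, so the
    -- remainder is small on both sides.
    have e : p * G * q = p * (p' * G) * q + (p * (1 - p')) * G * ((1 - q') * q) := by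
      have hk : (1 - p') * G * (1 - q') = (1 - p') * G := by
        rw [Matrix.mul_sub, Matrix.mul_one, Matrix.mul_assoc, hG, ← Matrix.mul_assoc,
          Matrix.sub_mul 1 p' p', Matrix.one_mul, hp, sub_self, Matrix.zero_mul, sub_zero]
      rw [← Matrix.mul_assoc _ (1 - q') q, Matrix.mul_assoc p (1 - p') G,
        Matrix.mul_assoc p _ (1 - q'), hk]
      simp only [Matrix.sub_mul, Matrix.mul_sub, Matrix.mul_assoc, Matrix.one_mul]
      abel
    rw [e]
    have h1 := frobNorm_mul_mul_le p (p' * G) q np le_rfl nq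
    have h2 := frobNorm_mul_mul_le (p * (1 - p')) G ((1 - q') * q) ph le_rfl kq
    refine (frobNorm_add_le _ _).trans ?_
    linarith
  -- The off-diagonal blocks of G are first order in θ, since G has none with respect to p', q'.
  have right : frobNorm ((1 - p) * G * q) ≤ 2 * θ * N := by
    have e : (1 - p) * G * q
        = (1 - p) * G * ((1 - q') * q) + ((1 - p) * p') * G * q := by
      rw [Matrix.mul_assoc (1 - p) p' G, ← hG]
      simp only [Matrix.sub_mul, Matrix.mul_sub, Matrix.mul_assoc, Matrix.one_mul]
      abel
    rw [e]
    have h1 := frobNorm_mul_mul_le (1 - p) G ((1 - q') * q) nh le_rfl kq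
    have h2 := frobNorm_mul_mul_le ((1 - p) * p') G q hp' le_rfl nq
    refine (frobNorm_add_le _ _).trans ?_
    linarith
  have left : frobNorm (p * G * (1 - q)) ≤ 2 * θ * N := by
    have e : p * G * (1 - q) = p * (1 - p') * G * (1 - q) + p * G * (q' * (1 - q)) := by
      rw [← Matrix.mul_assoc (p * G), Matrix.mul_assoc p G q', hG]
      simp only [Matrix.sub_mul, Matrix.mul_sub, Matrix.mul_assoc, Matrix.one_mul]
      abel
    rw [e]
    have h1 := frobNorm_mul_mul_le (p * (1 - p')) G (1 - q) ph le_rfl nk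
    have h2 := frobNorm_mul_mul_le p G (q' * (1 - q)) np le_rfl q'k
    refine (frobNorm_add_le _ _).trans ?_
    linarith
  have lower : frobNorm (p' * G) ≤ frobNorm (p * G * q) + 5 * θ ^ 2 * N := by
    have h1p : (1 - p) * (1 - p) = 1 - p := by
      rw [Matrix.mul_sub, Matrix.mul_one, Matrix.sub_mul, Matrix.one_mul, hpp, sub_self, sub_zero]
    have h1q : (1 - q) * (1 - q) = 1 - q := by
      rw [Matrix.mul_sub, Matrix.mul_one, Matrix.sub_mul, Matrix.one_mul, hqq, sub_self, sub_zero]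
    -- Block expansion of G by p and q. Idempotence uses 1 - p twice, once beside p' as a small
    -- factor and once inside a small block. The errors are 2θ² + 2θ² + θ² = 5θ².
    have e : p' * G = p' * (p * G * q) * q' + p' * (1 - p) * ((1 - p) * G * q) * q'
        + p' * (p * G * (1 - q)) * ((1 - q) * q') + p' * (1 - p) * G * ((1 - q) * q') := by
      have e1 : p' * (1 - p) * ((1 - p) * G * q) * q' = p' * ((1 - p) * G * q) * q' := by
        rw [Matrix.mul_assoc p', Matrix.mul_assoc (1 - p) G, ← Matrix.mul_assoc (1 - p), h1p]
      have e2 : p' * (p * G * (1 - q)) * ((1 - q) * q') = p' * (p * G * (1 - q)) * q' := by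
        rw [← Matrix.mul_assoc _ (1 - q) q', Matrix.mul_assoc p' _ (1 - q),
          Matrix.mul_assoc (p * G), h1q]
      rw [e1, e2, hpGq]
      simp only [Matrix.sub_mul, Matrix.mul_sub, Matrix.mul_assoc, Matrix.one_mul]
      abel
    rw [e]
    have h1 := frobNorm_mul_mul_le p' (p * G * q) q' np' le_rfl nq'
    have h2 := frobNorm_mul_mul_le (p' * (1 - p)) ((1 - p) * G * q) q' p'h right nq'
    have h3 := frobNorm_mul_mul_le p' (p * G * (1 - q)) ((1 - q) * q') np' left kq'
    have h4 := frobNorm_mul_mul_le (p' * (1 - p)) G ((1 - q) * q') p'h le_rfl kq'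
    refine (frobNorm_add_le _ _).trans ?_
    refine (add_le_add_left ((frobNorm_add_le _ _).trans
      (add_le_add_left (frobNorm_add_le _ _) _)) _).trans ?_
    linarith
  rw [abs_le]
  constructor
  · nlinarith [mul_nonneg (sq_nonneg θ) N0]
  · linarith

theorem specNorm_mul_comm_of_transpose {p q : Matrix (Fin m) (Fin m) ℝ} (hp : pᵀ = p)
    (hq : qᵀ = q) : specNorm (p * q) = specNorm (q * p) := by
  rw [← specNorm_transpose, Matrix.transpose_mul, hp, hq]

/-- The tail of a perturbed matrix is, up to second order in `τ`, its compression to the tail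
subspaces of the unperturbed matrix. -/
theorem abs_sqrt_tailEnergy_sub_le {S G : Matrix (Fin m) (Fin n) ℝ}
    {U : Matrix (Fin m) (Fin m) ℝ} {V : Matrix (Fin n) (Fin n) ℝ} (hS : IsSVD S U V) {r : ℕ}
    (hr : r ≤ min m n) (hgap : 0 < gap r S) {τ : ℝ} (hτ : τ ≤ 1 / 2)
    (hGS : specNorm (G - S) = τ * gap r S) :
    |Real.sqrt (tailEnergy r G) - frobNorm (complProj U r * G * complProj V r)| ≤
      20 * τ ^ 2 * frobNorm G := by
  obtain ⟨U', V', hG⟩ := exists_isSVD G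
  have hSG : specNorm (S - G) = τ * gap r S := by rw [← hGS, ← specNorm_neg, neg_sub]
  have hδ : gap r S = sv S (r - 1) - sv S r := rfl
  have hg : 0 < gap r S / 2 := by linarith
  -- Weyl's inequality moves each singular value by at most τδ ≤ δ/2, leaving gap δ/2 in both Wedin
  -- applications; hence θ = 2τ.
  have w1 := sv_le_add_specNorm S G (r - 1)
  have w2 := sv_le_add_specNorm G S r
  have hτg : τ * gap r S ≤ gap r S / 2 := by nlinarith
  obtain ⟨a1, a2⟩ := wedin_sin_theta hS hG hr hg (by linarith)
  obtain ⟨b1, b2⟩ := wedin_sin_theta hG hS hr hg (by linarith)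
  have close : ∀ {x : ℝ}, gap r S / 2 * x ≤ τ * gap r S → x ≤ 2 * τ := fun {x} hx => by
    refine le_of_mul_le_mul_left ?_ hg
    linarith
  rw [hGS] at a1 a2
  rw [hSG] at b1 b2
  have t : ∀ {k : ℕ} (W : Matrix (Fin k) (Fin k) ℝ), (1 - complProj W r)ᵀ = 1 - complProj W r :=
    fun W => by rw [Matrix.transpose_sub, complProj_transpose, Matrix.transpose_one]
  rw [← hG.frobNorm_complProj_mul_sq, Real.sqrt_sq (frobNorm_nonneg _)]
  have := abs_frobNorm_compression_sub_le (θ := 2 * τ)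
    (complProj_mul_self hS.left_orthogonal r) (complProj_mul_self hS.right_orthogonal r)
    (complProj_mul_self hG.left_orthogonal r)
    (hG.mul_complProj r)
    (specNorm_complProj_le hS.left_orthogonal r) (specNorm_complProj_le hS.right_orthogonal r)
    (specNorm_complProj_le hG.left_orthogonal r) (specNorm_complProj_le hG.right_orthogonal r)
    (specNorm_one_sub_complProj_le hS.left_orthogonal r)
    (specNorm_one_sub_complProj_le hS.right_orthogonal r)
    (close a1)
    ((specNorm_mul_comm_of_transpose (t U) (complProj_transpose U' r)).trans_le (close b1))
    (close b1) (close a2)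
    ((specNorm_mul_comm_of_transpose (complProj_transpose V' r) (t V)).trans_le (close b2))
    (close b2)
  refine this.trans_eq ?_
  ring

theorem tailEnergy_nonneg (r : ℕ) (A : Matrix (Fin m) (Fin n) ℝ) : 0 ≤ tailEnergy r A :=
  Finset.sum_nonneg fun _ _ => sq_nonneg _

theorem tailEnergy_le (r : ℕ) (A : Matrix (Fin m) (Fin n) ℝ) :
    tailEnergy r A ≤ frobNorm A ^ 2 := by
  rw [frobNorm_sq_eq_sum_sv, tailEnergy]
  refine Finset.sum_le_sum_of_subset_of_nonneg ?_ fun i _ _ => sq_nonneg _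
  intro i hi
  exact Finset.mem_range.2 (Finset.mem_Ico.1 hi).2

/-- The r-th singular value of S is at least the gap, and the perturbation removes at most half of
the gap. -/
theorem frobNorm_pos_of_gap_pos {S G : Matrix (Fin m) (Fin n) ℝ} {r : ℕ} (hr1 : 1 ≤ r)
    (hr : r ≤ min m n) (hgap : 0 < gap r S) {τ : ℝ} (hτ : τ ≤ 1 / 2)
    (hGS : specNorm (G - S) = τ * gap r S) : 0 < frobNorm G := by
  have hSG : specNorm (S - G) = τ * gap r S := by rw [← hGS, ← specNorm_neg, neg_sub]
  have h := sv_le_add_specNorm S G (r - 1)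
  have hδ : gap r S = sv S (r - 1) - sv S r := rfl
  have hpos : 0 < sv G (r - 1) := by nlinarith [sv_nonneg S r]
  have hle : sv G (r - 1) ^ 2 ≤ frobNorm G ^ 2 := by
    rw [frobNorm_sq_eq_sum_sv]
    exact Finset.single_le_sum (f := fun i => sv G i ^ 2) (fun i _ => sq_nonneg _)
      (Finset.mem_range.2 (by omega))
  exact hpos.trans_le (le_of_sq_le_sq hle (frobNorm_nonneg G))

end Perturbation

end FSFOA

/-! ### The main theorem. -/

theorem theorem2 :
    ∃ τ₀ C₁ C' : ℝ, 0 < τ₀ ∧ τ₀ < 1 ∧ 0 < C₁ ∧ 0 < C' ∧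
      ∀ (m n r : ℕ) (S D : Matrix (Fin m) (Fin n) ℝ)
        (U : Matrix (Fin m) (Fin m) ℝ) (V : Matrix (Fin n) (Fin n) ℝ),
        1 ≤ r → r < min m n → FSFOA.IsSVD S U V → 0 < FSFOA.gap r S →
        ∀ β ∈ Set.Icc (0 : ℝ) 1, FSFOA.relPert r S D β ≤ τ₀ →
        ∀ P_L P_R S_perp D_perp G,
          P_L = FSFOA.complProj U r → P_R = FSFOA.complProj V r →
          S_perp = P_L * S * P_R → D_perp = P_L * D * P_R → G = S + β • D →
          -- the tail energy is the squared error of the best approximation of rank at most `r`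
          IsLeast {e : ℝ | ∃ Q : Matrix (Fin m) (Fin n) ℝ, Q.rank ≤ r ∧
            e = FSFOA.frobNorm (G - Q) ^ 2} (FSFOA.tailEnergy r G) ∧
          -- the tail energy is approximated to second order in `τ`
          |FSFOA.tailEnergy r G - FSFOA.frobNorm (S_perp + β • D_perp) ^ 2| ≤
            C₁ * FSFOA.relPert r S D β ^ 2 *
              (FSFOA.frobNorm S ^ 2 + β ^ 2 * FSFOA.frobNorm D ^ 2) ∧
          -- the fixed-subspace ratio, in its two forms, approximates the tail ratio
          FSFOA.frobNorm G ≠ 0 ∧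
          FSFOA.frobNorm (P_L * G * P_R) / FSFOA.frobNorm G =
            FSFOA.frobNorm (S_perp + β • D_perp) / FSFOA.frobNorm (S + β • D) ∧
          |FSFOA.tailRatio r G -
              FSFOA.frobNorm (S_perp + β • D_perp) / FSFOA.frobNorm (S + β • D)| ≤
            C' * FSFOA.relPert r S D β ^ 2 := by
  -- 20 = 5 · 2² comes from θ = 2τ. 80 = 20 · 2 · 2 comes from bounding the sum of the two tail
  -- norms by 2‖G‖_F, and ‖G‖_F² by 2(‖S‖_F² + β²‖D‖_F²).
  refine ⟨1 / 2, 80, 20, by norm_num, by norm_num, by norm_num, by norm_num, ?_⟩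
  rintro m n r S D U V hr1 hr hS hgap β ⟨hβ0, hβ1⟩ hτ P_L P_R S_perp D_perp G rfl rfl rfl rfl rfl
  set τ := FSFOA.relPert r S D β with hτdef
  set G := S + β • D with hG
  have hτ0 : 0 ≤ τ := div_nonneg (mul_nonneg hβ0 (FSFOA.specNorm_nonneg D)) hgap.le
  have hGS : FSFOA.specNorm (G - S) = τ * FSFOA.gap r S := by
    rw [hG, add_sub_cancel_left, FSFOA.specNorm_smul, abs_of_nonneg hβ0, hτdef, FSFOA.relPert,
      div_mul_cancel₀ _ hgap.ne']
  have hF : FSFOA.complProj U r * S * FSFOA.complProj V r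
      + β • (FSFOA.complProj U r * D * FSFOA.complProj V r)
      = FSFOA.complProj U r * G * FSFOA.complProj V r := by
    rw [hG, Matrix.mul_add, Matrix.add_mul, Matrix.mul_smul, Matrix.smul_mul]
  have hmain := FSFOA.abs_sqrt_tailEnergy_sub_le hS hr.le hgap hτ hGS
  have hN : 0 < FSFOA.frobNorm G := FSFOA.frobNorm_pos_of_gap_pos hr1 hr.le hgap hτ hGS
  have hF0 := FSFOA.frobNorm_nonneg (FSFOA.complProj U r * G * FSFOA.complProj V r)
  have hFN : FSFOA.frobNorm (FSFOA.complProj U r * G * FSFOA.complProj V r)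
      ≤ FSFOA.frobNorm G := by
    have h := FSFOA.frobNorm_mul_mul_le _ G _ (FSFOA.specNorm_complProj_le hS.left_orthogonal r)
      le_rfl (FSFOA.specNorm_complProj_le hS.right_orthogonal r)
    linarith
  have hE := FSFOA.tailEnergy_nonneg r G
  have hEN : Real.sqrt (FSFOA.tailEnergy r G) ≤ FSFOA.frobNorm G :=
    Real.sqrt_le_iff.2 ⟨hN.le, FSFOA.tailEnergy_le r G⟩
  have hNS : FSFOA.frobNorm G ≤ FSFOA.frobNorm S + β * FSFOA.frobNorm D := by
    have h := FSFOA.frobNorm_add_le S (β • D)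
    rwa [FSFOA.frobNorm_smul, abs_of_nonneg hβ0] at h
  rw [hF]
  refine ⟨FSFOA.isLeast_tailEnergy r G, ?_, hN.ne', rfl, ?_⟩
  · set x := Real.sqrt (FSFOA.tailEnergy r G) with hx
    set y := FSFOA.frobNorm (FSFOA.complProj U r * G * FSFOA.complProj V r)
    set N := FSFOA.frobNorm G
    have hx0 : 0 ≤ x := Real.sqrt_nonneg _
    have hsq : N ^ 2 ≤ 2 * (FSFOA.frobNorm S ^ 2 + β ^ 2 * FSFOA.frobNorm D ^ 2) := by
      have h := pow_le_pow_left₀ hN.le hNS 2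
      nlinarith [sq_nonneg (FSFOA.frobNorm S - β * FSFOA.frobNorm D)]
    rw [← Real.sq_sqrt hE, ← hx, sq_sub_sq, abs_mul, abs_of_nonneg (add_nonneg hx0 hF0)]
    calc (x + y) * |x - y| ≤ (2 * N) * (20 * τ ^ 2 * N) :=
          mul_le_mul (by linarith) hmain (abs_nonneg _) (by linarith)
      _ = 40 * τ ^ 2 * N ^ 2 := by ring
      _ ≤ 40 * τ ^ 2 * (2 * (FSFOA.frobNorm S ^ 2 + β ^ 2 * FSFOA.frobNorm D ^ 2)) := by gcongr
      _ = _ := by ring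
  · rw [FSFOA.tailRatio, ← sub_div, abs_div, abs_of_pos hN, div_le_iff₀ hN]
    exact hmain
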